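/- Let $S_\infty=\bigcup_{n\ge 0}S_n$ be the group of permutations of $\{1,2,\dots\}$ moving finitely many points, let $s_i=(i,i+1)$, and let $$\partial_i f=\frac{f-f|_{x_i\leftrightarrow x_{i+1}}}{x_i-x_{i+1}}$$ be the divided difference operators on $\mathbb{Z}[x_1,x_2,\dots]$. For $w\in S_\infty$ put $\partial_w=\partial_{i_1}\cdots\partial_{i_\ell}$ for any reduced decomposition $w=s_{i_1}\cdots s_{i_\ell}$. The single Schubert polynomials $\mathfrak{S}_w(x)$, $w\in S_\infty$, are determined by $\mathfrak{S}_{n\cdots 21}(x)=\prod_{i+j\le n}x_i$ (product over $i,j\geq 1$) and $\partial_i\mathfrak{S}_w=\mathfrak{S}_{ws_i}$ whenever $w(i)>w(i+1)$. For $w\in S_\infty$ the skew divided difference operators $\partial_{w/v}$, $v\in S_\infty$ (all but finitely many of them zero), are the linear operators on $\mathbb{Z}[x_1,x_2,\dots]$ characterized by $$\partial_w(fg)=\sum_{v}(\partial_{w/v}f)(\partial_v g)\qquad\text{for all } f,g .$$ Let $u,v\in S_\infty$ have separated descents, that is, for some integer $k\ge 0$, $$\max\{i: u(i)>u(i+1)\}\le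 k\le \min\{i: v(i)>v(i+1)\},$$ where the maximum is read as $0$ if $u=\mathrm{id}$ and the minimum as $+\infty$ if $v=\mathrm{id}$. Then for every $w\in S_\infty$ the polynomial $\partial_{w/v}\mathfrak{S}_u(x)$ has nonnegative integer coefficients: $$\partial_{w/v}\mathfrak{S}_u(x)\in\mathbb{Z}_{\ge 0}[x_1,x_2,\dots].$$ -/

import Mathlib

/-! ## Permutations, words and reduced words

All indices are shifted down by one: the position `i : ℕ` stands for the position `i + 1` of the
usual one-line notation `w(1) w(2) ⋯`, and `X i` stands for the variable `x_{i+1}`. -/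

namespace SchubertCalc

open MvPolynomial

/-- The group `S_∞ = ⋃ₙ Sₙ` of the permutations that move only finitely many points. -/
def SInf : Subgroup (Equiv.Perm ℕ) where
  carrier := {w | ∃ n, ∀ i, n ≤ i → w i = i}
  one_mem' := ⟨0, fun _ _ => rfl⟩
  mul_mem' := by
    rintro a b ⟨n, hn⟩ ⟨m, hm⟩
    refine ⟨max n m, fun i hi => ?_⟩
    rw [Equiv.Perm.mul_apply, hm i (le_trans (le_max_right _ _) hi),
      hn i (le_trans (le_max_left _ _) hi)]
  inv_mem' := by
    rintro a ⟨n, hn⟩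
    refine ⟨n, fun i hi => ?_⟩
    rw [Equiv.Perm.inv_eq_iff_eq, hn i hi]

/-- The simple transposition exchanging the positions `i` and `i + 1`. -/
def simpleRefl (i : ℕ) : SInf :=
  ⟨Equiv.swap i (i + 1), i + 2, fun j hj => Equiv.swap_apply_of_ne_of_ne (by omega) (by omega)⟩

/-- The longest element `n ⋯ 2 1` of `Sₙ`. -/
def longest (n : ℕ) : SInf :=
  ⟨Function.Involutive.toPerm (fun i => if i < n then n - 1 - i else i)
    (fun i => by dsimp only; split_ifs <;> omega), n, fun i hi => by
      simp [Function.Involutive.toPerm, Nat.not_lt.mpr hi]⟩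

/-- The product `s_{a₁} s_{a₂} ⋯ s_{aₗ}` of a word. -/
def wordProd (a : List ℕ) : SInf := (a.map simpleRefl).prod

/-- `a` is a reduced decomposition of `w`: its product is `w`, and no word with product `w`
is shorter. -/
def IsReducedWord (a : List ℕ) (w : SInf) : Prop :=
  wordProd a = w ∧ ∀ b : List ℕ, wordProd b = w → a.length ≤ b.length

/-- The largest descent position (in the usual numbering), which is `0` for the identity. -/
noncomputable def maxdes (w : SInf) : ℕ∞ :=
  ⨆ i ∈ {i : ℕ | w.1 (i + 1) < w.1 i}, ((i + 1 : ℕ) : ℕ∞)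

/-- The smallest descent position (in the usual numbering), which is `∞` for the identity. -/
noncomputable def mindes (w : SInf) : ℕ∞ :=
  ⨅ i ∈ {i : ℕ | w.1 (i + 1) < w.1 i}, ((i + 1 : ℕ) : ℕ∞)

/-- `u` and `v` have separated descents: `maxdes u ≤ k ≤ mindes v` for some position `k`. -/
def SeparatedDescents (u v : SInf) : Prop :=
  ∃ k : ℕ, maxdes u ≤ (k : ℕ∞) ∧ (k : ℕ∞) ≤ mindes v

/-! ### Inversions -/

/-- The set of inversions of `w`. -/
def invSet (w : SInf) : Set (ℕ × ℕ) := {p | p.1 < p.2 ∧ w.1 p.2 < w.1 p.1}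

/-- The number of inversions of `w`. -/
noncomputable def invNum (w : SInf) : ℕ := (invSet w).ncard

/-- `i` occurs before `i + 1` in the one-line notation of `w`. -/
def LeftAsc (i : ℕ) (w : SInf) : Prop := (w⁻¹).1 i < (w⁻¹).1 (i + 1)

theorem simpleRefl_mul_self (i : ℕ) : simpleRefl i * simpleRefl i = 1 :=
  Subtype.ext (Equiv.swap_mul_self _ _)

theorem simpleRefl_inv (i : ℕ) : (simpleRefl i)⁻¹ = simpleRefl i :=
  inv_eq_of_mul_eq_one_left (simpleRefl_mul_self i)

theorem simpleRefl_cancel (i : ℕ) (w : SInf) : simpleRefl i * (simpleRefl i * w) = w := by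
  rw [← mul_assoc, simpleRefl_mul_self, one_mul]

theorem simpleRefl_cancel_right (i : ℕ) (w : SInf) : w * simpleRefl i * simpleRefl i = w := by
  rw [mul_assoc, simpleRefl_mul_self, mul_one]

theorem inv_simple_mul_apply (i : ℕ) (w : SInf) (j : ℕ) :
    ((simpleRefl i * w)⁻¹).1 j = (w⁻¹).1 (Equiv.swap i (i + 1) j) := by
  rw [mul_inv_rev, simpleRefl_inv]; rfl

theorem inv_apply_ne (w : SInf) {i j : ℕ} (h : i ≠ j) : (w⁻¹).1 i ≠ (w⁻¹).1 j :=
  fun h' => h ((w⁻¹).1.injective h')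

theorem not_leftAsc {i : ℕ} {w : SInf} : ¬ LeftAsc i w ↔ LeftAsc i (simpleRefl i * w) := by
  unfold LeftAsc
  rw [inv_simple_mul_apply, inv_simple_mul_apply, Equiv.swap_apply_left,
    Equiv.swap_apply_right, not_lt]
  exact ⟨fun h => lt_of_le_of_ne h (inv_apply_ne w (by omega)), le_of_lt⟩

theorem invSet_finite (w : SInf) : (invSet w).Finite := by
  obtain ⟨n, hn⟩ := w.2
  refine Set.Finite.subset ((Set.finite_Iio n).prod (Set.finite_Iio n)) ?_
  rintro ⟨p, q⟩ ⟨h1, h2⟩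
  dsimp only at h1 h2
  have hq : q < n := by
    by_contra hq
    have e := hn q (by omega)
    have e2 := hn (w.1 p) (by omega)
    have := w.1.injective e2
    omega
  exact ⟨by simp only [Set.mem_Iio]; omega, hq⟩

theorem invNum_mul_of_asc {i : ℕ} {w : SInf} (h : LeftAsc i w) :
    invNum (simpleRefl i * w) = invNum w + 1 := by
  have key : invSet (simpleRefl i * w) =
      insert ((w⁻¹).1 i, (w⁻¹).1 (i + 1)) (invSet w) := by
    ext ⟨p, q⟩
    have e1 : ∀ x, (w⁻¹).1 (w.1 x) = x := fun x => w.1.symm_apply_apply x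
    have e2 : ∀ x, w.1 ((w⁻¹).1 x) = x := fun x => w.1.apply_symm_apply x
    have e3 : ∀ x, (simpleRefl i * w).1 x = Equiv.swap i (i + 1) (w.1 x) := fun x => rfl
    unfold LeftAsc at h
    simp only [invSet, Set.mem_ofPred_eq, Set.mem_insert_iff, Prod.mk.injEq, e3]
    have hp : p = (w⁻¹).1 i ↔ w.1 p = i :=
      ⟨fun h => by rw [h, e2], fun h => by rw [← h, e1]⟩
    have hq : q = (w⁻¹).1 (i + 1) ↔ w.1 q = i + 1 :=
      ⟨fun h => by rw [h, e2], fun h => by rw [← h, e1]⟩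
    have hp' : p = (w⁻¹).1 (i + 1) ↔ w.1 p = i + 1 :=
      ⟨fun h => by rw [h, e2], fun h => by rw [← h, e1]⟩
    have hq' : q = (w⁻¹).1 i ↔ w.1 q = i :=
      ⟨fun h => by rw [h, e2], fun h => by rw [← h, e1]⟩
    have hne : p < q → w.1 p ≠ w.1 q := fun hlt he => by
      have := w.1.injective he; omega
    rw [hp, hq]
    simp only [Equiv.swap_apply_def]
    split_ifs <;> omega
  have hnot : ((w⁻¹).1 i, (w⁻¹).1 (i + 1)) ∉ invSet w := by
    rintro ⟨_, h2⟩
    have e2 : ∀ x, w.1 ((w⁻¹).1 x) = x := fun x => w.1.apply_symm_apply x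
    simp only [e2] at h2
    omega
  rw [invNum, key, Set.ncard_insert_of_notMem hnot (invSet_finite w), invNum]

theorem invNum_mul_of_not_asc {i : ℕ} {w : SInf} (h : ¬ LeftAsc i w) :
    invNum w = invNum (simpleRefl i * w) + 1 := by
  have := invNum_mul_of_asc (not_leftAsc.mp h)
  rwa [simpleRefl_cancel] at this

theorem invNum_one : invNum 1 = 0 := by
  have : invSet 1 = ∅ := by
    ext ⟨p, q⟩
    simp only [invSet, Set.mem_ofPred_eq, Set.mem_empty_iff_false, iff_false]
    rintro ⟨h1, h2⟩
    have h2' : q < p := h2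
    omega
  rw [invNum, this, Set.ncard_empty]

theorem wordProd_nil : wordProd [] = 1 := rfl

theorem wordProd_cons (i : ℕ) (a : List ℕ) : wordProd (i :: a) = simpleRefl i * wordProd a := rfl

theorem wordProd_append (a b : List ℕ) : wordProd (a ++ b) = wordProd a * wordProd b := by
  simp [wordProd]

theorem wordProd_reverse (a : List ℕ) : wordProd a.reverse = (wordProd a)⁻¹ := by
  induction a with
  | nil => simp [wordProd]
  | cons i a ih =>
    rw [List.reverse_cons, wordProd_append, ih, wordProd_cons, wordProd_cons, wordProd_nil,
      mul_one, mul_inv_rev, simpleRefl_inv]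

theorem invNum_wordProd_le (a : List ℕ) : invNum (wordProd a) ≤ a.length := by
  induction a with
  | nil => simp [wordProd_nil, invNum_one]
  | cons i a ih =>
    rw [wordProd_cons, List.length_cons]
    by_cases h : LeftAsc i (wordProd a)
    · rw [invNum_mul_of_asc h]; omega
    · have := invNum_mul_of_not_asc h; omega

theorem eq_one_of_asc {w : SInf} (h : ∀ i, LeftAsc i w) : w = 1 := by
  have hm : StrictMono (w⁻¹).1 := strictMono_nat_of_lt_succ h
  have hm' : StrictMono w.1 := by
    intro a b hab
    by_contra hc
    have := hm.monotone (not_lt.mp hc)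
    have e1 : ∀ x, (w⁻¹).1 (w.1 x) = x := fun x => w.1.symm_apply_apply x
    rw [e1, e1] at this
    omega
  refine Subtype.ext (Equiv.ext fun x => ?_)
  have h1 := hm'.le_apply (x := x)
  have h2 := hm.le_apply (x := w.1 x)
  have e1 : (w⁻¹).1 (w.1 x) = x := w.1.symm_apply_apply x
  rw [e1] at h2
  exact le_antisymm h2 h1

theorem exists_word (w : SInf) : ∃ a, wordProd a = w ∧ a.length = invNum w := by
  induction hn : invNum w using Nat.strong_induction_on generalizing w with
  | _ n ih =>
    by_cases h : ∀ i, LeftAsc i w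
    · have hw := eq_one_of_asc h
      refine ⟨[], by rw [hw, wordProd_nil], ?_⟩
      rw [← hn, hw, invNum_one, List.length_nil]
    · push Not at h
      obtain ⟨i, hi⟩ := h
      have e := invNum_mul_of_not_asc hi
      obtain ⟨a, ha, hl⟩ := ih _ (by omega) (simpleRefl i * w) rfl
      refine ⟨i :: a, by rw [wordProd_cons, ha, simpleRefl_cancel], ?_⟩
      rw [List.length_cons, hl]; omega

theorem isReducedWord_iff {a : List ℕ} {w : SInf} :
    IsReducedWord a w ↔ wordProd a = w ∧ a.length = invNum w := by
  refine and_congr_right fun h => ⟨fun hm => ?_, fun hl b hb => ?_⟩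
  · obtain ⟨b, hb, hbl⟩ := exists_word w
    have h1 := hm b hb
    have h2 := invNum_wordProd_le a
    rw [h] at h2
    omega
  · have h2 := invNum_wordProd_le b
    rw [hb] at h2
    omega

theorem exists_isReducedWord (w : SInf) : ∃ a, IsReducedWord a w :=
  (exists_word w).imp fun _ => isReducedWord_iff.mpr

theorem isReducedWord_cons {i : ℕ} {a : List ℕ} {w : SInf} :
    IsReducedWord (i :: a) w ↔
      IsReducedWord a (simpleRefl i * w) ∧ LeftAsc i (simpleRefl i * w) := by
  rw [isReducedWord_iff, isReducedWord_iff, wordProd_cons, List.length_cons]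
  constructor
  · rintro ⟨h1, h2⟩
    have e : wordProd a = simpleRefl i * w := by rw [← h1, simpleRefl_cancel]
    have hle := invNum_wordProd_le a
    rw [e] at hle
    have hasc : LeftAsc i (simpleRefl i * w) := by
      by_contra hc
      have := invNum_mul_of_not_asc hc
      rw [simpleRefl_cancel] at this
      omega
    have := invNum_mul_of_asc hasc
    rw [simpleRefl_cancel] at this
    exact ⟨⟨e, by omega⟩, hasc⟩
  · rintro ⟨⟨h1, h2⟩, h3⟩
    have := invNum_mul_of_asc h3
    rw [simpleRefl_cancel] at this
    exact ⟨by rw [h1, simpleRefl_cancel], by omega⟩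

theorem isReducedWord_cons_of_asc {i : ℕ} {a : List ℕ} {w : SInf} (h : IsReducedWord a w)
    (hi : LeftAsc i w) : IsReducedWord (i :: a) (simpleRefl i * w) := by
  rw [isReducedWord_cons, simpleRefl_cancel]
  exact ⟨h, hi⟩

theorem isReducedWord_reverse {a : List ℕ} {w : SInf} (h : IsReducedWord a w) :
    IsReducedWord a.reverse w⁻¹ := by
  refine ⟨by rw [wordProd_reverse, h.1], fun b hb => ?_⟩
  have := h.2 b.reverse (by rw [wordProd_reverse, hb, inv_inv])
  simpa using this

theorem invNum_inv (w : SInf) : invNum w⁻¹ = invNum w := by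
  obtain ⟨a, ha⟩ := exists_isReducedWord w
  rw [← (isReducedWord_iff.mp ha).2, ← (isReducedWord_iff.mp (isReducedWord_reverse ha)).2,
    List.length_reverse]

/-! ## Divided difference operators -/

/-- The ring `ℤ[x₁, x₂, …]`. -/
abbrev Poly : Type := MvPolynomial ℕ ℤ

/-- The exchange `f ↦ f|_{x_i ↔ x_{i+1}}` of two adjacent variables. -/
noncomputable def swapVars (i : ℕ) : Poly →ₐ[ℤ] Poly := rename (Equiv.swap i (i + 1))

theorem dvd_sub_swapVars (i : ℕ) (f : Poly) : (X i - X (i + 1) : Poly) ∣ f - swapVars i f := by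
  rw [← Ideal.mem_span_singleton, ← Ideal.Quotient.mk_eq_mk_iff_sub_mem]
  set I : Ideal Poly := Ideal.span {(X i - X (i + 1) : Poly)} with hI
  have hx : Ideal.Quotient.mkₐ ℤ I (X i) = Ideal.Quotient.mkₐ ℤ I (X (i + 1)) :=
    (Ideal.Quotient.mk_eq_mk_iff_sub_mem _ _).mpr (Ideal.mem_span_singleton_self _)
  have key : Ideal.Quotient.mkₐ ℤ I = (Ideal.Quotient.mkₐ ℤ I).comp (swapVars i) := by
    refine MvPolynomial.algHom_ext fun j => ?_
    rw [AlgHom.comp_apply, swapVars, rename_X, Equiv.swap_apply_def]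
    split_ifs with h1 h2
    · rw [h1, hx]
    · rw [h2, hx]
    · rfl
  exact DFunLike.congr_fun key f

/-- The divided difference `∂_i f = (f - f|_{x_i ↔ x_{i+1}}) / (x_i - x_{i+1})`, as the quotient
of an exact division. -/
noncomputable def divDiffFun (i : ℕ) (f : Poly) : Poly := (dvd_sub_swapVars i f).choose

theorem divDiffFun_spec (i : ℕ) (f : Poly) :
    (X i - X (i + 1)) * divDiffFun i f = f - swapVars i f :=
  (dvd_sub_swapVars i f).choose_spec.symm

theorem X_sub_X_ne_zero {i j : ℕ} (h : i ≠ j) : (X i - X j : Poly) ≠ 0 :=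
  sub_ne_zero.mpr fun e => h (X_injective e)

/-- The divided difference operator `∂_i`. -/
noncomputable def simpleDivDiff (i : ℕ) : Module.End ℤ Poly where
  toFun := divDiffFun i
  map_add' f g := by
    apply mul_left_cancel₀ (X_sub_X_ne_zero (Nat.succ_ne_self i).symm)
    rw [mul_add, divDiffFun_spec, divDiffFun_spec, divDiffFun_spec, map_add]
    ring
  map_smul' c f := by
    apply mul_left_cancel₀ (X_sub_X_ne_zero (Nat.succ_ne_self i).symm)
    rw [RingHom.id_apply, mul_smul_comm, divDiffFun_spec, divDiffFun_spec, map_smul, smul_sub]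

theorem simpleDivDiff_spec (i : ℕ) (f : Poly) :
    (X i - X (i + 1)) * simpleDivDiff i f = f - swapVars i f := divDiffFun_spec i f

theorem simpleDivDiff_eq {i : ℕ} {f g : Poly} (h : (X i - X (i + 1)) * g = f - swapVars i f) :
    simpleDivDiff i f = g := by
  apply mul_left_cancel₀ (X_sub_X_ne_zero (Nat.succ_ne_self i).symm)
  rw [simpleDivDiff_spec, h]

theorem swapVars_X (i j : ℕ) : swapVars i (X j) = X (Equiv.swap i (i + 1) j) := by
  rw [swapVars, rename_X]

theorem swapVars_left (i : ℕ) : swapVars i (X i) = X (i + 1) := by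
  rw [swapVars_X, Equiv.swap_apply_left]

theorem swapVars_right (i : ℕ) : swapVars i (X (i + 1)) = X i := by
  rw [swapVars_X, Equiv.swap_apply_right]

theorem swapVars_of_ne {i j : ℕ} (h1 : j ≠ i) (h2 : j ≠ i + 1) : swapVars i (X j) = X j := by
  rw [swapVars_X, Equiv.swap_apply_of_ne_of_ne h1 h2]

theorem swapVars_swapVars (i : ℕ) (f : Poly) : swapVars i (swapVars i f) = f := by
  have : (swapVars i).comp (swapVars i) = AlgHom.id ℤ Poly := by
    refine MvPolynomial.algHom_ext fun j => ?_
    rw [AlgHom.comp_apply, swapVars_X, swapVars_X, Equiv.swap_apply_self]; rfl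
  exact DFunLike.congr_fun this f

theorem swapVars_simpleDivDiff (i : ℕ) (f : Poly) :
    swapVars i (simpleDivDiff i f) = simpleDivDiff i f := by
  have h := congrArg (swapVars i) (simpleDivDiff_spec i f)
  rw [map_mul, map_sub, map_sub, swapVars_left, swapVars_right, swapVars_swapVars] at h
  apply mul_left_cancel₀ (X_sub_X_ne_zero (Nat.succ_ne_self i).symm)
  have h' := simpleDivDiff_spec i f
  linear_combination -h - h'

theorem simpleDivDiff_of_symm {i : ℕ} {f : Poly} (h : swapVars i f = f) :
    simpleDivDiff i f = 0 := simpleDivDiff_eq (by rw [h, mul_zero, sub_self])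

theorem simpleDivDiff_sq (i : ℕ) : simpleDivDiff i * simpleDivDiff i = 0 :=
  LinearMap.ext fun f => simpleDivDiff_of_symm (swapVars_simpleDivDiff i f)

theorem simpleDivDiff_mul (i : ℕ) (f g : Poly) :
    simpleDivDiff i (f * g) = simpleDivDiff i f * g + swapVars i f * simpleDivDiff i g := by
  refine simpleDivDiff_eq ?_
  have h1 := simpleDivDiff_spec i f
  have h2 := simpleDivDiff_spec i g
  rw [map_mul]
  linear_combination g * h1 + swapVars i f * h2

theorem swapVars_comm {i j : ℕ} (h : i + 2 ≤ j) (f : Poly) :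
    swapVars i (swapVars j f) = swapVars j (swapVars i f) := by
  have : (swapVars i).comp (swapVars j) = (swapVars j).comp (swapVars i) := by
    refine MvPolynomial.algHom_ext fun k => ?_
    rw [AlgHom.comp_apply, AlgHom.comp_apply, swapVars_X, swapVars_X, swapVars_X, swapVars_X]
    congr 1
    simp only [Equiv.swap_apply_def]
    split_ifs <;> omega
  exact DFunLike.congr_fun this f

theorem swapVars_braid (i : ℕ) (f : Poly) :
    swapVars i (swapVars (i + 1) (swapVars i f)) =
      swapVars (i + 1) (swapVars i (swapVars (i + 1) f)) := by
  have : (swapVars i).comp ((swapVars (i + 1)).comp (swapVars i)) =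
      (swapVars (i + 1)).comp ((swapVars i).comp (swapVars (i + 1))) := by
    refine MvPolynomial.algHom_ext fun k => ?_
    simp only [AlgHom.comp_apply, swapVars_X]
    congr 1
    simp only [Equiv.swap_apply_def]
    split_ifs <;> omega
  exact DFunLike.congr_fun this f

theorem simpleDivDiff_comm {i j : ℕ} (h : i + 2 ≤ j) :
    simpleDivDiff i * simpleDivDiff j = simpleDivDiff j * simpleDivDiff i := by
  refine LinearMap.ext fun f => ?_
  rw [Module.End.mul_apply, Module.End.mul_apply]
  refine simpleDivDiff_eq ?_
  apply mul_left_cancel₀ (X_sub_X_ne_zero (Nat.succ_ne_self j).symm)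
  have h1 := simpleDivDiff_spec j (simpleDivDiff i f)
  have h2 := simpleDivDiff_spec i f
  have h3 := simpleDivDiff_spec j f
  have h4 := congrArg (swapVars i) h3
  have h5 := congrArg (swapVars j) h2
  rw [map_mul, map_sub, map_sub, swapVars_of_ne (by omega) (by omega),
    swapVars_of_ne (by omega) (by omega), swapVars_comm h] at h4
  rw [map_mul, map_sub, map_sub, swapVars_of_ne (by omega) (by omega),
    swapVars_of_ne (by omega) (by omega)] at h5
  linear_combination (X i - X (i + 1)) * h1 + h2 - h5 - h3 + h4

theorem simpleDivDiff_braid (i : ℕ) :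
    simpleDivDiff i * (simpleDivDiff (i + 1) * simpleDivDiff i) =
      simpleDivDiff (i + 1) * (simpleDivDiff i * simpleDivDiff (i + 1)) := by
  refine LinearMap.ext fun f => ?_
  simp only [Module.End.mul_apply]
  have ab : (X i - X (i + 1) : Poly) ≠ 0 := X_sub_X_ne_zero (by omega)
  have ac : (X i - X (i + 1 + 1) : Poly) ≠ 0 := X_sub_X_ne_zero (by omega)
  have bc : (X (i + 1) - X (i + 1 + 1) : Poly) ≠ 0 := X_sub_X_ne_zero (by omega)
  have sc : swapVars i (X (i + 1 + 1)) = X (i + 1 + 1) := swapVars_of_ne (by omega) (by omega)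
  have ta : swapVars (i + 1) (X i) = X i := swapVars_of_ne (by omega) (by omega)
  have hbr := swapVars_braid i f
  have sA := swapVars_simpleDivDiff i f
  have sA' := swapVars_simpleDivDiff (i + 1) f
  have h1 := simpleDivDiff_spec i f
  have h1' := simpleDivDiff_spec (i + 1) f
  have h2 := simpleDivDiff_spec (i + 1) (simpleDivDiff i f)
  have h2' := simpleDivDiff_spec i (simpleDivDiff (i + 1) f)
  have h3 := simpleDivDiff_spec i (simpleDivDiff (i + 1) (simpleDivDiff i f))
  have h3' := simpleDivDiff_spec (i + 1) (simpleDivDiff i (simpleDivDiff (i + 1) f))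
  have k2 := congrArg (swapVars i) h2
  have k2' := congrArg (swapVars (i + 1)) h2'
  have k1 := congrArg (swapVars (i + 1)) h1
  have k1' := congrArg (swapVars i) h1'
  simp only [map_mul, map_sub, swapVars_left, swapVars_right, sc, ta, sA, sA'] at k1 k1' k2 k2'
  have l1 := congrArg (swapVars i) k1
  have l1' := congrArg (swapVars (i + 1)) k1'
  simp only [map_mul, map_sub, swapVars_left, swapVars_right, sc, ta] at l1 l1'
  apply mul_left_cancel₀ (mul_ne_zero (mul_ne_zero ab ac) bc)
  have L : (X i - X (i + 1)) * (X i - X (i + 1 + 1)) * (X (i + 1) - X (i + 1 + 1)) *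
      simpleDivDiff i (simpleDivDiff (i + 1) (simpleDivDiff i f)) =
      f - swapVars i f - swapVars (i + 1) f + swapVars (i + 1) (swapVars i f) +
        swapVars i (swapVars (i + 1) f) - swapVars i (swapVars (i + 1) (swapVars i f)) := by
    linear_combination (X i - X (i + 1 + 1)) * (X (i + 1) - X (i + 1 + 1)) * h3 +
      (X i - X (i + 1 + 1)) * h2 - (X (i + 1) - X (i + 1 + 1)) * k2 + h1 - k1 + l1
  have R : (X i - X (i + 1)) * (X i - X (i + 1 + 1)) * (X (i + 1) - X (i + 1 + 1)) *
      simpleDivDiff (i + 1) (simpleDivDiff i (simpleDivDiff (i + 1) f)) =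
      f - swapVars i f - swapVars (i + 1) f + swapVars (i + 1) (swapVars i f) +
        swapVars i (swapVars (i + 1) f) -
        swapVars (i + 1) (swapVars i (swapVars (i + 1) f)) := by
    linear_combination (X i - X (i + 1 + 1)) * (X i - X (i + 1)) * h3' +
      (X i - X (i + 1 + 1)) * h2' - (X i - X (i + 1)) * k2' + h1' - k1' + l1'
  rw [L, R, hbr]

/-- The composition `∂_{a₁} ∂_{a₂} ⋯ ∂_{aₗ}` along a word. -/
noncomputable def wordDivDiff (a : List ℕ) : Module.End ℤ Poly := (a.map simpleDivDiff).prod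

theorem wordDivDiff_cons (i : ℕ) (a : List ℕ) :
    wordDivDiff (i :: a) = simpleDivDiff i * wordDivDiff a := rfl

theorem simpleRefl_comm {i j : ℕ} (h : i + 1 < j) :
    simpleRefl j * simpleRefl i = simpleRefl i * simpleRefl j := by
  refine Subtype.ext (Equiv.ext fun k => ?_)
  change Equiv.swap j (j + 1) (Equiv.swap i (i + 1) k) =
    Equiv.swap i (i + 1) (Equiv.swap j (j + 1) k)
  simp only [Equiv.swap_apply_def]
  split_ifs <;> omega

theorem simpleRefl_braid (i : ℕ) :
    simpleRefl i * (simpleRefl (i + 1) * simpleRefl i) =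
      simpleRefl (i + 1) * (simpleRefl i * simpleRefl (i + 1)) := by
  refine Subtype.ext (Equiv.ext fun k => ?_)
  change Equiv.swap i (i + 1) (Equiv.swap (i + 1) (i + 1 + 1) (Equiv.swap i (i + 1) k)) =
    Equiv.swap (i + 1) (i + 1 + 1) (Equiv.swap i (i + 1) (Equiv.swap (i + 1) (i + 1 + 1) k))
  simp only [Equiv.swap_apply_def]
  split_ifs <;> omega

/-- The case of two different first letters. -/
theorem wordDivDiff_eq_aux {i j : ℕ} (hij : i < j) {a b : List ℕ} {w : SInf}
    (ha : IsReducedWord (i :: a) w) (hb : IsReducedWord (j :: b) w)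
    (ih : ∀ c, ∀ (a' b' : List ℕ), IsReducedWord a' c → IsReducedWord b' c →
      a'.length ≤ a.length → wordDivDiff a' = wordDivDiff b') :
    wordDivDiff (i :: a) = wordDivDiff (j :: b) := by
  have hlen : a.length = b.length := by
    have h1 := (isReducedWord_iff.mp ha).2
    have h2 := (isReducedWord_iff.mp hb).2
    simp only [List.length_cons] at h1 h2
    omega
  obtain ⟨ra, da⟩ := isReducedWord_cons.mp ha
  obtain ⟨rb, db⟩ := isReducedWord_cons.mp hb
  unfold LeftAsc at da db
  simp only [inv_simple_mul_apply, Equiv.swap_apply_left, Equiv.swap_apply_right] at da db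
  rcases Nat.lt_or_ge (i + 1) j with h | h
  · have hcomm : simpleRefl j * (simpleRefl i * w) = simpleRefl i * (simpleRefl j * w) := by
      rw [← mul_assoc, ← mul_assoc, simpleRefl_comm h]
    obtain ⟨c, hc⟩ := exists_isReducedWord (simpleRefl j * (simpleRefl i * w))
    have r1 : IsReducedWord (j :: c) (simpleRefl i * w) := by
      refine isReducedWord_cons.mpr ⟨hc, ?_⟩
      unfold LeftAsc
      simp only [inv_simple_mul_apply, Equiv.swap_apply_left, Equiv.swap_apply_right]
      rw [Equiv.swap_apply_of_ne_of_ne (by omega) (by omega),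
        Equiv.swap_apply_of_ne_of_ne (by omega) (by omega)]
      exact db
    have r2 : IsReducedWord (i :: c) (simpleRefl j * w) := by
      refine isReducedWord_cons.mpr ⟨by rw [← hcomm]; exact hc, ?_⟩
      unfold LeftAsc
      simp only [inv_simple_mul_apply, Equiv.swap_apply_left, Equiv.swap_apply_right]
      rw [Equiv.swap_apply_of_ne_of_ne (by omega) (by omega),
        Equiv.swap_apply_of_ne_of_ne (by omega) (by omega)]
      exact da
    rw [wordDivDiff_cons, wordDivDiff_cons, ih _ _ _ ra r1 le_rfl,
      ih _ _ _ rb r2 hlen.ge, wordDivDiff_cons, wordDivDiff_cons, ← mul_assoc, ← mul_assoc,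
      simpleDivDiff_comm (by omega)]
  · obtain rfl : j = i + 1 := by omega
    have hbraid : simpleRefl i * (simpleRefl (i + 1) * (simpleRefl i * w)) =
        simpleRefl (i + 1) * (simpleRefl i * (simpleRefl (i + 1) * w)) := by
      have := congrArg (· * w) (simpleRefl_braid i)
      simpa only [mul_assoc] using this
    have e1 : Equiv.swap i (i + 1) (i + 1 + 1) = i + 1 + 1 :=
      Equiv.swap_apply_of_ne_of_ne (by omega) (by omega)
    have e2 : Equiv.swap (i + 1) (i + 1 + 1) i = i :=
      Equiv.swap_apply_of_ne_of_ne (by omega) (by omega)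
    obtain ⟨c, hc⟩ := exists_isReducedWord
      (simpleRefl i * (simpleRefl (i + 1) * (simpleRefl i * w)))
    have r1 : IsReducedWord ((i + 1) :: i :: c) (simpleRefl i * w) := by
      refine isReducedWord_cons.mpr ⟨isReducedWord_cons.mpr ⟨hc, ?_⟩, ?_⟩ <;>
      · unfold LeftAsc
        simp only [inv_simple_mul_apply, Equiv.swap_apply_left, Equiv.swap_apply_right, e1, e2]
        omega
    have r2 : IsReducedWord (i :: (i + 1) :: c) (simpleRefl (i + 1) * w) := by
      refine isReducedWord_cons.mpr ⟨isReducedWord_cons.mpr ⟨by rw [← hbraid]; exact hc, ?_⟩, ?_⟩ <;>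
      · unfold LeftAsc
        simp only [inv_simple_mul_apply, Equiv.swap_apply_left, Equiv.swap_apply_right, e1, e2]
        omega
    rw [wordDivDiff_cons, wordDivDiff_cons, ih _ _ _ ra r1 le_rfl, ih _ _ _ rb r2 hlen.ge]
    simp only [wordDivDiff_cons]
    have := congrArg (· * wordDivDiff c) (simpleDivDiff_braid i)
    simpa only [mul_assoc] using this

/-- The operators along two reduced words of the same permutation agree. -/
theorem wordDivDiff_eq {w : SInf} {a b : List ℕ} (ha : IsReducedWord a w)
    (hb : IsReducedWord b w) : wordDivDiff a = wordDivDiff b := by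
  induction hn : a.length using Nat.strong_induction_on generalizing w a b with
  | _ n ih =>
    have hlen : a.length = b.length := by
      rw [(isReducedWord_iff.mp ha).2, (isReducedWord_iff.mp hb).2]
    match a, b, hlen with
    | [], [], _ => rfl
    | i :: a, j :: b, hl =>
      simp only [List.length_cons] at hn hl
      rcases lt_trichotomy i j with h | h | h
      · exact wordDivDiff_eq_aux h ha hb fun c a' b' h1 h2 h3 => ih _ (by omega) h1 h2 rfl
      · subst h
        rw [wordDivDiff_cons, wordDivDiff_cons,
          ih _ (by omega) (isReducedWord_cons.mp ha).1 (isReducedWord_cons.mp hb).1 rfl]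
      · exact (wordDivDiff_eq_aux h hb ha fun c a' b' h1 h2 h3 => ih _ (by omega) h1 h2 rfl).symm

/-- The operator `∂_w = ∂_{a₁} ⋯ ∂_{aₗ}`, for any reduced decomposition `w = s_{a₁} ⋯ s_{aₗ}`. -/
noncomputable def divDiff (w : SInf) : Module.End ℤ Poly :=
  wordDivDiff (exists_isReducedWord w).choose

theorem divDiff_eq {w : SInf} {a : List ℕ} (h : IsReducedWord a w) :
    divDiff w = wordDivDiff a := wordDivDiff_eq (exists_isReducedWord w).choose_spec h

theorem divDiff_one : divDiff 1 = 1 :=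
  divDiff_eq (a := []) ⟨rfl, fun _ _ => Nat.zero_le _⟩

theorem divDiff_simple_mul {i : ℕ} {w : SInf} (h : LeftAsc i w) :
    divDiff (simpleRefl i * w) = simpleDivDiff i * divDiff w := by
  obtain ⟨a, ha⟩ := exists_isReducedWord w
  rw [divDiff_eq (isReducedWord_cons_of_asc ha h), divDiff_eq ha, wordDivDiff_cons]

theorem simpleDivDiff_mul_divDiff_of_not {i : ℕ} {w : SInf} (h : ¬ LeftAsc i w) :
    simpleDivDiff i * divDiff w = 0 := by
  have h' := divDiff_simple_mul (not_leftAsc.mp h)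
  rw [simpleRefl_cancel] at h'
  rw [h', ← mul_assoc, simpleDivDiff_sq, zero_mul]

/-! ## Schubert polynomials -/

/-- The monomial `x₁ⁿ⁻¹ x₂ⁿ⁻² ⋯ x_{n-1}`, that is, the product of `x_i` over `i + j ≤ n`. -/
noncomputable def staircase (n : ℕ) : Poly := ∏ i ∈ Finset.range n, X i ^ (n - 1 - i)

/-- The two properties that determine the (single) Schubert polynomials: the value at `n ⋯ 2 1`,
and `∂_i 𝔖_w = 𝔖_{w s_i}` whenever `w` has a descent at `i`. -/
def IsSchubertFamily (S : SInf → Poly) : Prop :=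
  (∀ n, S (longest n) = staircase n) ∧
    ∀ (w : SInf) (i : ℕ), w.1 (i + 1) < w.1 i → simpleDivDiff i (S w) = S (w * simpleRefl i)

/-- The polynomial of `w` computed by descending from the longest element of `Sₙ`. -/
noncomputable def schubertAt (n : ℕ) (w : SInf) : Poly := divDiff (w⁻¹ * longest n) (staircase n)

theorem longest_inv (n : ℕ) : (longest n)⁻¹ = longest n := by
  refine inv_eq_of_mul_eq_one_left (Subtype.ext (Equiv.ext fun i => ?_))
  change (if (if i < n then n - 1 - i else i) < n then n - 1 - (if i < n then n - 1 - i else i)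
    else (if i < n then n - 1 - i else i)) = i
  split_ifs <;> omega

theorem longest_apply (n i : ℕ) : (longest n).1 i = if i < n then n - 1 - i else i := rfl

theorem lt_bound_of_descent {n : ℕ} {w : SInf} (hw : ∀ i, n ≤ i → w.1 i = i) {i : ℕ}
    (h : w.1 (i + 1) < w.1 i) : i + 1 < n := by
  by_contra hc
  have e := hw (i + 1) (by omega)
  have := w.1.injective (hw (w.1 i) (by omega))
  omega

theorem apply_lt_bound {n : ℕ} {w : SInf} (hw : ∀ i, n ≤ i → w.1 i = i) {i : ℕ}
    (h : i < n) : w.1 i < n := by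
  by_contra hc
  have := w.1.injective (hw (w.1 i) (by omega))
  omega

theorem mul_simple_inv_mul (w z : SInf) (i : ℕ) :
    (w * simpleRefl i)⁻¹ * z = simpleRefl i * (w⁻¹ * z) := by
  rw [mul_inv_rev, simpleRefl_inv, mul_assoc]

theorem leftAsc_longest {n : ℕ} {w : SInf} (hw : ∀ i, n ≤ i → w.1 i = i) {i : ℕ}
    (hi : i + 1 < n) : LeftAsc i (w⁻¹ * longest n) ↔ w.1 (i + 1) < w.1 i := by
  have e : ∀ j, ((w⁻¹ * longest n)⁻¹).1 j = (longest n).1 (w.1 j) := by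
    intro j
    rw [mul_inv_rev, inv_inv, longest_inv]; rfl
  unfold LeftAsc
  rw [e, e, longest_apply, longest_apply, if_pos (apply_lt_bound hw (by omega)),
    if_pos (apply_lt_bound hw hi)]
  have := apply_lt_bound hw hi
  have := apply_lt_bound hw (show i < n by omega)
  omega

theorem schubertAt_step {n : ℕ} {w : SInf} (hw : ∀ i, n ≤ i → w.1 i = i) {i : ℕ}
    (h : w.1 (i + 1) < w.1 i) :
    simpleDivDiff i (schubertAt n w) = schubertAt n (w * simpleRefl i) := by
  have ha := (leftAsc_longest hw (lt_bound_of_descent hw h)).mpr h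
  rw [schubertAt, schubertAt, mul_simple_inv_mul, divDiff_simple_mul ha, Module.End.mul_apply]

theorem schubertAt_longest (n : ℕ) : schubertAt n (longest n) = staircase n := by
  rw [schubertAt, inv_mul_cancel, divDiff_one, Module.End.one_apply]

/-- Descending induction from the longest element of `Sₙ`. -/
theorem descending_induction {n : ℕ} {P : SInf → Prop} (h0 : P (longest n))
    (hs : ∀ (w : SInf) (i : ℕ), (∀ j, n ≤ j → w.1 j = j) → w.1 (i + 1) < w.1 i → P w →
      P (w * simpleRefl i)) (w : SInf) (hw : ∀ j, n ≤ j → w.1 j = j) : P w := by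
  induction hm : invNum (w⁻¹ * longest n) using Nat.strong_induction_on generalizing w with
  | _ m ih =>
    by_cases h : ∀ i, LeftAsc i (w⁻¹ * longest n)
    · have := eq_one_of_asc h
      rw [inv_mul_eq_one] at this
      rwa [this]
    · push Not at h
      obtain ⟨i, hi⟩ := h
      have hin : i + 1 < n := by
        by_contra hc
        apply hi
        unfold LeftAsc
        have e : ∀ j, ((w⁻¹ * longest n)⁻¹).1 j = (longest n).1 (w.1 j) := by
          intro j
          rw [mul_inv_rev, inv_inv, longest_inv]; rfl
        rw [e, e, hw (i + 1) (by omega), longest_apply n (i + 1), if_neg (by omega),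
          longest_apply]
        by_cases hin : i < n
        · have := apply_lt_bound hw hin
          rw [if_pos this]; omega
        · rw [hw i (by omega), if_neg hin]; omega
      have hasc : ¬ w.1 (i + 1) < w.1 i := fun hc => hi ((leftAsc_longest hw hin).mpr hc)
      have hw' : ∀ j, n ≤ j → (w * simpleRefl i).1 j = j := by
        intro j hj
        have : (w * simpleRefl i).1 j = w.1 (Equiv.swap i (i + 1) j) := rfl
        rw [this, Equiv.swap_apply_of_ne_of_ne (by omega) (by omega), hw j hj]
      have hlt : (w * simpleRefl i).1 (i + 1) < (w * simpleRefl i).1 i := by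
        have e : ∀ j, (w * simpleRefl i).1 j = w.1 (Equiv.swap i (i + 1) j) := fun j => rfl
        rw [e, e, Equiv.swap_apply_left, Equiv.swap_apply_right]
        have : w.1 i ≠ w.1 (i + 1) := fun h => by
          have := w.1.injective h; omega
        omega
      have hinv := invNum_mul_of_not_asc hi
      rw [← mul_simple_inv_mul] at hinv
      have := hs _ i hw' hlt (ih _ (by omega) _ hw' rfl)
      rwa [simpleRefl_cancel_right] at this

/-- The permutation `n, n-1, …` with the largest entry of `S_{n+1}` in position `j`. -/
def slide (n : ℕ) : ℕ → SInf
  | 0 => longest (n + 1)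
  | j + 1 => slide n j * simpleRefl j

theorem slide_apply {n j : ℕ} (hj : j ≤ n) (i : ℕ) : (slide n j).1 i =
    if i < j then n - 1 - i else if i = j then n else if i ≤ n then n - i else i := by
  induction j generalizing i with
  | zero =>
    rw [slide, longest_apply]
    split_ifs <;> omega
  | succ j ih =>
    have e : (slide n (j + 1)).1 i = (slide n j).1 (Equiv.swap j (j + 1) i) := rfl
    rw [e, ih (by omega)]
    simp only [Equiv.swap_apply_def]
    split_ifs <;> omega

theorem slide_self (n : ℕ) : slide n n = longest n := by
  refine Subtype.ext (Equiv.ext fun i => ?_)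
  rw [slide_apply le_rfl, longest_apply]
  split_ifs <;> omega

theorem staircase_succ (n : ℕ) :
    staircase (n + 1) = staircase n * ∏ i ∈ Finset.Ico 0 n, (X i : Poly) := by
  rw [staircase, staircase, Finset.prod_range_succ, ← Finset.range_eq_Ico,
    ← Finset.prod_mul_distrib]
  simp only [Nat.add_sub_cancel, Nat.sub_self, pow_zero, mul_one]
  refine Finset.prod_congr rfl fun i hi => ?_
  rw [← pow_succ]
  congr 1
  have := Finset.mem_range.mp hi
  omega

theorem swapVars_prod_pow {j N : ℕ} (hj : j + 1 < N) (e : ℕ → ℕ) (he : e j = e (j + 1)) :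
    swapVars j (∏ i ∈ Finset.range N, (X i : Poly) ^ e i) = ∏ i ∈ Finset.range N, X i ^ e i := by
  rw [map_prod]
  refine Finset.prod_bij (fun i _ => Equiv.swap j (j + 1) i) ?_ ?_ ?_ ?_
  · intro i hi
    rw [Finset.mem_range] at hi ⊢
    rw [Equiv.swap_apply_def]
    split_ifs <;> omega
  · intro a _ b _ h
    exact (Equiv.swap j (j + 1)).injective h
  · intro b hb
    refine ⟨Equiv.swap j (j + 1) b, ?_, Equiv.swap_apply_self _ _ _⟩
    rw [Finset.mem_range] at hb ⊢
    rw [Equiv.swap_apply_def]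
    split_ifs <;> omega
  · intro i _
    rw [map_pow, swapVars_X]
    congr 1
    rw [Equiv.swap_apply_def]
    split_ifs with h1 h2
    · rw [h1, he]
    · rw [h2, he]
    · rfl

theorem staircase_mul_symm {n j : ℕ} (hj : j < n) :
    swapVars j (staircase n * ∏ i ∈ Finset.Ico (j + 1) n, (X i : Poly)) =
      staircase n * ∏ i ∈ Finset.Ico (j + 1) n, X i := by
  have e : staircase n * ∏ i ∈ Finset.Ico (j + 1) n, (X i : Poly) =
      ∏ i ∈ Finset.range (n + 1), X i ^ (n - 1 - i + if j + 1 ≤ i ∧ i < n then 1 else 0) := by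
    rw [Finset.prod_congr rfl fun i _ => pow_add (X i : Poly) _ _, Finset.prod_mul_distrib]
    congr 1
    · rw [Finset.prod_range_succ, staircase]
      simp
    · rw [← Finset.prod_filter_mul_prod_filter_not (Finset.range (n + 1))
        (fun i => j + 1 ≤ i ∧ i < n)]
      have h1 : (Finset.range (n + 1)).filter (fun i => j + 1 ≤ i ∧ i < n) =
          Finset.Ico (j + 1) n := by
        ext i
        simp only [Finset.mem_filter, Finset.mem_range, Finset.mem_Ico]
        omega
      have h2 : ∀ i ∈ Finset.Ico (j + 1) n,
          (X i : Poly) ^ (if j + 1 ≤ i ∧ i < n then 1 else 0) = X i := fun i hi => by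
        rw [if_pos (Finset.mem_Ico.mp hi), pow_one]
      rw [h1, Finset.prod_congr rfl h2, Finset.prod_eq_one (s := Finset.filter _ _), mul_one]
      intro i hi
      rw [if_neg (Finset.mem_filter.mp hi).2, pow_zero]
  rw [e, swapVars_prod_pow (by omega)]
  split_ifs <;> omega

theorem schubertAt_slide {n j : ℕ} (hj : j ≤ n) :
    schubertAt (n + 1) (slide n j) = staircase n * ∏ i ∈ Finset.Ico j n, (X i : Poly) := by
  induction j with
  | zero => rw [slide, schubertAt_longest, staircase_succ]
  | succ j ih =>
    have hw : ∀ i, n + 1 ≤ i → (slide n j).1 i = i := by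
      intro i hi
      rw [slide_apply (by omega)]
      split_ifs <;> omega
    have hd : (slide n j).1 (j + 1) < (slide n j).1 j := by
      rw [slide_apply (by omega), slide_apply (by omega)]
      split_ifs <;> omega
    rw [slide, ← schubertAt_step hw hd, ih (by omega),
      Finset.prod_eq_prod_Ico_succ_bot (show j < n by omega)]
    refine simpleDivDiff_eq ?_
    have hs := staircase_mul_symm (show j < n by omega)
    rw [show staircase n * (X j * ∏ i ∈ Finset.Ico (j + 1) n, (X i : Poly)) =
      X j * (staircase n * ∏ i ∈ Finset.Ico (j + 1) n, (X i : Poly)) by ring,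
      map_mul, hs, swapVars_left]
    ring

theorem schubertAt_succ {n : ℕ} (w : SInf) (hw : ∀ i, n ≤ i → w.1 i = i) :
    schubertAt (n + 1) w = schubertAt n w := by
  refine descending_induction (P := fun w => schubertAt (n + 1) w = schubertAt n w) ?_ ?_ w hw
  · rw [schubertAt_longest, ← slide_self, schubertAt_slide le_rfl, Finset.Ico_self,
      Finset.prod_empty, mul_one]
  · intro w i hw h ih
    rw [← schubertAt_step hw h, ← schubertAt_step (fun j hj => hw j (by omega)) h, ih]

theorem schubertAt_stable {n m : ℕ} (h : n ≤ m) (w : SInf) (hw : ∀ i, n ≤ i → w.1 i = i) :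
    schubertAt m w = schubertAt n w := by
  induction m, h using Nat.le_induction with
  | base => rfl
  | succ m hm ih => rw [schubertAt_succ w fun i hi => hw i (by omega), ih]

theorem existsUnique_isSchubertFamily : ∃! S, IsSchubertFamily S := by
  have hval : ∀ (w : SInf) (n : ℕ), (∀ i, n ≤ i → w.1 i = i) →
      schubertAt w.2.choose w = schubertAt n w := by
    intro w n hn
    rw [← schubertAt_stable (le_max_left w.2.choose n) w w.2.choose_spec,
      schubertAt_stable (le_max_right w.2.choose n) w hn]
  have hlong : ∀ n i, n ≤ i → (longest n).1 i = i := by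
    intro n i hi
    rw [longest_apply, if_neg (by omega)]
  refine ⟨fun w => schubertAt w.2.choose w, ⟨fun n => ?_, fun w i h => ?_⟩, fun T hT => ?_⟩
  · dsimp only
    rw [hval _ n (hlong n), schubertAt_longest]
  · dsimp only
    have hw := w.2.choose_spec
    have hi := lt_bound_of_descent hw h
    rw [schubertAt_step hw h, hval (w * simpleRefl i) w.2.choose]
    intro j hj
    have : (w * simpleRefl i).1 j = w.1 (Equiv.swap i (i + 1) j) := rfl
    rw [this, Equiv.swap_apply_of_ne_of_ne (by omega) (by omega), hw j hj]
  · funext w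
    refine descending_induction (n := w.2.choose)
      (P := fun z => T z = schubertAt w.2.choose z) ?_ ?_ w w.2.choose_spec
    · rw [hT.1, schubertAt_longest]
    · intro z i hz h ih
      rw [← hT.2 z i h, ih, schubertAt_step hz h]

/-- The single Schubert polynomials `𝔖_w`. -/
noncomputable def schubert : SInf → Poly := existsUnique_isSchubertFamily.choose

theorem isSchubertFamily_schubert : IsSchubertFamily schubert :=
  existsUnique_isSchubertFamily.choose_spec.1

/-! ## Skew divided difference operators -/

/-- The characterization of the family `(∂_{w/v})_v` (zero for all but finitely many `v`):
`∂_w (f g) = ∑_v (∂_{w/v} f) (∂_v g)` for all `f` and `g`. -/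
def IsSkewFamily (w : SInf) (D : SInf →₀ Module.End ℤ Poly) : Prop :=
  ∀ f g : Poly, divDiff w (f * g) = D.sum fun v T => T f * divDiff v g

theorem exists_isSkewFamily (w : SInf) : ∃ D, IsSkewFamily w D := by
  classical
  obtain ⟨a, ha⟩ := exists_isReducedWord w
  induction a generalizing w with
  | nil =>
    obtain rfl : 1 = w := ha.1
    refine ⟨Finsupp.single 1 1, fun f g => ?_⟩
    rw [Finsupp.sum_single_index (by simp), divDiff_one]
    rfl
  | cons i a ih =>
    obtain ⟨h1, h2⟩ := isReducedWord_cons.mp ha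
    obtain ⟨D, hD⟩ := ih _ h1
    have hw := divDiff_simple_mul h2
    rw [simpleRefl_cancel] at hw
    let A : SInf → Module.End ℤ Poly → (SInf →₀ Module.End ℤ Poly) := fun v T =>
      Finsupp.single v (simpleDivDiff i * T) +
        if LeftAsc i v then Finsupp.single (simpleRefl i * v) ((swapVars i).toLinearMap * T) else 0
    refine ⟨D.sum A, fun f g => ?_⟩
    rw [hw, Module.End.mul_apply, hD f g, Finsupp.sum_sum_index (by simp)
      (by intro v T T'; rw [LinearMap.add_apply, add_mul]), Finsupp.sum, map_sum, Finsupp.sum]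
    refine Finset.sum_congr rfl fun v _ => ?_
    rw [simpleDivDiff_mul, Finsupp.sum_add_index' (by simp)
      (by intro v T T'; rw [LinearMap.add_apply, add_mul]), Finsupp.sum_single_index (by simp)]
    congr 1
    split_ifs with h
    · rw [Finsupp.sum_single_index (by simp), divDiff_simple_mul h]
      rfl
    · rw [Finsupp.sum_zero_index, ← Module.End.mul_apply, simpleDivDiff_mul_divDiff_of_not h,
        LinearMap.zero_apply, mul_zero]

theorem schubert_one : schubert 1 = 1 := by
  have h : longest 0 = 1 := Subtype.ext (Equiv.ext fun i => by rw [longest_apply]; rfl)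
  rw [← h, isSchubertFamily_schubert.1 0, staircase, Finset.prod_range_zero]

theorem wordDivDiff_schubert (a : List ℕ) : ∀ (w v : SInf), IsReducedWord a.reverse w →
    invNum v ≤ invNum w → v ≠ w → wordDivDiff a.reverse (schubert v) = 0 := by
  induction a with
  | nil =>
    intro w v hw hv hne
    have h1 : 1 = w := hw.1
    subst h1
    obtain ⟨b, hb, hl⟩ := exists_word v
    rw [invNum_one] at hv
    have : b = [] := List.length_eq_zero_iff.mp (by omega)
    subst this
    exact absurd hb.symm hne
  | cons i a ih =>
    intro w v hw hv hne
    have hw' := isReducedWord_reverse hw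
    rw [List.reverse_reverse] at hw'
    obtain ⟨r1, r2⟩ := isReducedWord_cons.mp hw'
    have r1' := isReducedWord_reverse r1
    rw [mul_inv_rev, inv_inv, simpleRefl_inv] at r1'
    have hinvw : invNum w = invNum (w * simpleRefl i) + 1 := by
      have := invNum_mul_of_asc r2
      rw [simpleRefl_cancel, invNum_inv] at this
      rw [this, ← invNum_inv (simpleRefl i * w⁻¹), mul_inv_rev, inv_inv, simpleRefl_inv]
    have hsplit : wordDivDiff (i :: a).reverse = wordDivDiff a.reverse * simpleDivDiff i := by
      rw [List.reverse_cons, wordDivDiff, List.map_append, List.prod_append]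
      simp [wordDivDiff]
    rw [hsplit, Module.End.mul_apply]
    by_cases hd : v.1 (i + 1) < v.1 i
    · rw [isSchubertFamily_schubert.2 v i hd]
      have hasc : ¬ LeftAsc i v⁻¹ := by
        unfold LeftAsc
        rw [inv_inv]; omega
      have hinvv := invNum_mul_of_not_asc hasc
      rw [invNum_inv, ← invNum_inv (simpleRefl i * v⁻¹), mul_inv_rev, inv_inv,
        simpleRefl_inv] at hinvv
      exact ih _ _ r1' (by omega) fun h => hne (mul_right_cancel h)
    · have hlt : (v * simpleRefl i).1 (i + 1) < (v * simpleRefl i).1 i := by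
        have e : ∀ j, (v * simpleRefl i).1 j = v.1 (Equiv.swap i (i + 1) j) := fun j => rfl
        rw [e, e, Equiv.swap_apply_left, Equiv.swap_apply_right]
        have : v.1 i ≠ v.1 (i + 1) := fun h => by
          have := v.1.injective h; omega
        omega
      have hs := isSchubertFamily_schubert.2 _ i hlt
      rw [simpleRefl_cancel_right] at hs
      rw [← hs, ← Module.End.mul_apply (simpleDivDiff i), simpleDivDiff_sq,
        LinearMap.zero_apply, map_zero]

theorem divDiff_schubert_of_ne {w v : SInf} (h : invNum v ≤ invNum w) (hne : v ≠ w) :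
    divDiff w (schubert v) = 0 := by
  obtain ⟨a, ha⟩ := exists_isReducedWord w
  rw [divDiff_eq ha]
  have := wordDivDiff_schubert a.reverse w v (by rwa [List.reverse_reverse]) h hne
  rwa [List.reverse_reverse] at this

theorem divDiff_schubert_self (w : SInf) : divDiff w (schubert w) = 1 := by
  obtain ⟨a, ha⟩ := exists_isReducedWord w⁻¹
  induction a generalizing w with
  | nil =>
    have h : w = 1 := inv_eq_one.mp (ha.1.symm.trans wordProd_nil)
    rw [h, divDiff_one, schubert_one]
    rfl
  | cons i a ih =>
    obtain ⟨r1, r2⟩ := isReducedWord_cons.mp ha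
    have e : simpleRefl i * w⁻¹ = (w * simpleRefl i)⁻¹ := by
      rw [mul_inv_rev, simpleRefl_inv]
    have hd : w.1 (i + 1) < w.1 i := by
      have := not_leftAsc.mpr r2
      unfold LeftAsc at this
      rw [inv_inv] at this
      have hne : w.1 i ≠ w.1 (i + 1) := fun h => by
        have := w.1.injective h; omega
      omega
    rw [e] at r1
    have r1' := isReducedWord_reverse r1
    have r0' := isReducedWord_reverse ha
    rw [inv_inv] at r1' r0'
    have h1 := ih _ r1
    rw [divDiff_eq r1'] at h1
    rw [divDiff_eq r0', List.reverse_cons, wordDivDiff, List.map_append, List.prod_append,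
      Module.End.mul_apply]
    have : (List.map simpleDivDiff [i]).prod = simpleDivDiff i := by simp
    rw [this, isSchubertFamily_schubert.2 w i hd]
    exact h1

theorem existsUnique_isSkewFamily (w : SInf) : ∃! D, IsSkewFamily w D := by
  classical
  obtain ⟨D, hD⟩ := exists_isSkewFamily w
  refine ⟨D, hD, fun D' hD' => ?_⟩
  have key : ∀ v, (D' - D) v = 0 := by
    intro v
    induction hn : invNum v using Nat.strong_induction_on generalizing v with
    | _ n ih =>
      refine LinearMap.ext fun f => ?_
      have h : (D' - D).sum (fun z T => T f * divDiff z (schubert v)) = 0 := by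
        rw [Finsupp.sum_sub_index (by intro z T T'; rw [LinearMap.sub_apply, sub_mul]),
          ← hD, ← hD', sub_self]
      rw [Finsupp.sum, Finset.sum_eq_single v] at h
      · rw [divDiff_schubert_self, mul_one] at h
        rw [h, LinearMap.zero_apply]
      · intro z _ hz
        by_cases hlt : invNum z < invNum v
        · rw [ih _ (by omega) z rfl, LinearMap.zero_apply, zero_mul]
        · rw [divDiff_schubert_of_ne (by omega) hz.symm, mul_zero]
      · intro hv
        rw [Finsupp.notMem_support_iff.mp hv, LinearMap.zero_apply, zero_mul]
  exact sub_eq_zero.mp (Finsupp.ext key)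

/-- The skew divided difference operator `∂_{w/v}`. -/
noncomputable def skewDivDiff (w v : SInf) : Module.End ℤ Poly :=
  (existsUnique_isSkewFamily w).choose v

end SchubertCalc

namespace SchubertCalc

open MvPolynomial

/-! ## Right multiplication by a simple transposition -/

/-! The operators `∂_v` are linearly independent over the polynomials, so the expansion of the
operator `g ↦ ∂_w (f g)` in the `∂_v` determines every `∂_{w/v} f`. Comparing expansions gives two
rules. The product rule `∂_{w/v}(f f') = ∑_z ∂_{w/z}(f) ∂_{z/v}(f')` makes the polynomials all of
whose skew divided differences are nonnegative closed under multiplication (`SkewPositive.mul`). The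
recursion `skewDivDiff_of_desc` at a descent `i` of `w` expresses `∂_{w/v} f` through `w s_i`, by
`∂_i f` and, if `v` also descends at `i`, by `s_i f`.

Separated descents enter through `nonneg_skewDivDiff_simpleDivDiff`. If `v` ascends at `i`, the
second term of the recursion is absent, so `∂_{w/v} ∂_i` equals `∂_{w s_i/v}` when `w` ascends at
`i`, and is zero otherwise. Hence positivity for `u s_i` against this `v` and all `w` gives
positivity for `u` whenever `u` and `v` both ascend at `i`, because then `𝔖_u = ∂_i 𝔖_{u s_i}`.
Since `v` ascends at every position before `k`, `u` may be raised until it descends at all of them.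
As `u` still ascends from `k` on, it is then dominant, and `𝔖_u` is the monomial of its code, with
weakly decreasing exponents.

Such a monomial is a product of factors `x₁ ⋯ x_m`, so only these remain. A descent of `w` before
`m` is removed by symmetry of the factor. If there is none, positions `1, …, m` are left-to-right
maxima of `w`. For products of distinct variables at left-to-right maxima, the recursion produces
only products of the same kind, with no signs (`nonneg_skewDivDiff_prod_X`). -/

theorem mul_simple_apply (w : SInf) (i j : ℕ) :
    (w * simpleRefl i).1 j = w.1 (Equiv.swap i (i + 1) j) := rfl

theorem apply_ne (w : SInf) {i j : ℕ} (h : i ≠ j) : w.1 i ≠ w.1 j :=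
  fun h' => h (w.1.injective h')

theorem leftAsc_inv {i : ℕ} {w : SInf} : LeftAsc i w⁻¹ ↔ w.1 i < w.1 (i + 1) := by
  unfold LeftAsc
  rw [inv_inv]

theorem invNum_mul_simple {i : ℕ} {w : SInf} (h : w.1 i < w.1 (i + 1)) :
    invNum (w * simpleRefl i) = invNum w + 1 := by
  rw [← invNum_inv, mul_inv_rev, simpleRefl_inv, invNum_mul_of_asc (leftAsc_inv.mpr h), invNum_inv]

theorem asc_mul_simple_iff {i : ℕ} {w : SInf} :
    (w * simpleRefl i).1 i < (w * simpleRefl i).1 (i + 1) ↔ w.1 (i + 1) < w.1 i := by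
  rw [mul_simple_apply, mul_simple_apply, Equiv.swap_apply_left, Equiv.swap_apply_right]

theorem divDiff_mul_simple {i : ℕ} {w : SInf} (h : w.1 i < w.1 (i + 1)) :
    divDiff (w * simpleRefl i) = divDiff w * simpleDivDiff i := by
  obtain ⟨a, ha⟩ := exists_isReducedWord w
  have hr := isReducedWord_reverse
    (isReducedWord_cons_of_asc (isReducedWord_reverse ha) (leftAsc_inv.mpr h))
  rw [List.reverse_cons, List.reverse_reverse, mul_inv_rev, inv_inv, simpleRefl_inv] at hr
  rw [divDiff_eq hr, divDiff_eq ha, wordDivDiff, List.map_append, List.prod_append]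
  simp [wordDivDiff]

/-- At a descent, `∂_w` already ends in the factor `∂_i`, and `∂_i² = 0`. -/
theorem divDiff_mul_simpleDivDiff_of_desc {i : ℕ} {w : SInf} (h : w.1 (i + 1) < w.1 i) :
    divDiff w * simpleDivDiff i = 0 := by
  have h' := divDiff_mul_simple (asc_mul_simple_iff.mpr h)
  rw [simpleRefl_cancel_right] at h'
  rw [h', mul_assoc, simpleDivDiff_sq, mul_zero]

theorem exists_descent {w : SInf} (h : w ≠ 1) : ∃ i, w.1 (i + 1) < w.1 i := by
  by_contra! hc
  refine h (inv_eq_one.mp (eq_one_of_asc fun i => leftAsc_inv.mpr ?_))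
  exact lt_of_le_of_ne (hc i) (apply_ne w (by omega))

theorem invNum_of_desc {i : ℕ} {w : SInf} (h : w.1 (i + 1) < w.1 i) :
    invNum w = invNum (w * simpleRefl i) + 1 := by
  rw [← invNum_mul_simple (asc_mul_simple_iff.mpr h), simpleRefl_cancel_right]

/-! ## Expansions in the operators `∂_v` -/

/-- The operators `∂_v` are linearly independent over the polynomials. -/
theorem eq_zero_of_sum_divDiff (E : SInf →₀ Poly)
    (h : ∀ g, (E.sum fun v a => a * divDiff v g) = 0) : E = 0 := by
  refine Finsupp.ext fun v => ?_
  induction hn : invNum v using Nat.strong_induction_on generalizing v with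
  | _ n ih =>
    -- Testing on `𝔖_v` isolates the coefficient of `∂_v`: shorter `z` have zero coefficient by
    -- induction, and every other `z ≠ v` kills `𝔖_v`.
    have hv := h (schubert v)
    rw [Finsupp.sum, Finset.sum_eq_single v] at hv
    · rwa [divDiff_schubert_self, mul_one] at hv
    · intro z _ hz
      by_cases hlt : invNum z < invNum v
      · rw [ih _ (by omega) z rfl, Finsupp.coe_zero, Pi.zero_apply, zero_mul]
      · rw [divDiff_schubert_of_ne (by omega) hz.symm, mul_zero]
    · intro hv
      rw [Finsupp.notMem_support_iff.mp hv, zero_mul]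

/-- The finitely supported family `v ↦ ∂_{w/v} f`. -/
noncomputable def skewCoeff (w : SInf) (f : Poly) : SInf →₀ Poly :=
  (existsUnique_isSkewFamily w).choose.mapRange (fun T => T f) (LinearMap.zero_apply f)

theorem skewCoeff_apply (w v : SInf) (f : Poly) : skewCoeff w f v = skewDivDiff w v f := rfl

theorem divDiff_mul_eq_sum (w : SInf) (f g : Poly) :
    divDiff w (f * g) = (skewCoeff w f).sum fun v a => a * divDiff v g := by
  rw [skewCoeff, Finsupp.sum_mapRange_index fun v => zero_mul _]
  exact (existsUnique_isSkewFamily w).choose_spec.1 f g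

/-- By linear independence of the `∂_v`, any expansion of `g ↦ ∂_w (f g)` must be the skew one.
Every formula for `∂_{w/v}` below is obtained by exhibiting such an expansion. -/
theorem skewCoeff_eq {w : SInf} {f : Poly} {E : SInf →₀ Poly}
    (h : ∀ g, divDiff w (f * g) = E.sum fun v a => a * divDiff v g) : skewCoeff w f = E := by
  refine sub_eq_zero.mp (eq_zero_of_sum_divDiff _ fun g => ?_)
  rw [Finsupp.sum_sub_index (by intros; rw [sub_mul]), ← h, ← divDiff_mul_eq_sum, sub_self]

theorem skewCoeff_one (f : Poly) : skewCoeff 1 f = Finsupp.single 1 f := by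
  refine skewCoeff_eq fun g => ?_
  rw [Finsupp.sum_single_index (zero_mul _), divDiff_one]
  rfl

/-- Associativity `(f f') g = f (f' g)`: expand first in `∂_z (f' g)`, then expand each of these in
the `∂_v g`. -/
theorem skewCoeff_mul (w : SInf) (f f' : Poly) :
    skewCoeff w (f * f') = (skewCoeff w f).sum fun z a => a • skewCoeff z f' := by
  refine skewCoeff_eq fun g => ?_
  rw [mul_assoc, divDiff_mul_eq_sum, Finsupp.sum_sum_index (fun _ => zero_mul _)
    (fun _ _ _ => add_mul _ _ _)]
  refine Finset.sum_congr rfl fun z _ => ?_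
  dsimp only
  rw [Finsupp.sum_smul_index' (fun _ => zero_mul _), divDiff_mul_eq_sum, Finsupp.mul_sum]
  simp only [smul_eq_mul, mul_assoc]

/-- The recursion for `∂_{w/v}` along a right factor `s_i`. -/
theorem skewDivDiff_mul_simple {i : ℕ} {w : SInf} (h : w.1 i < w.1 (i + 1)) (v : SInf)
    (f : Poly) : skewDivDiff (w * simpleRefl i) v f = skewDivDiff w v (simpleDivDiff i f) +
      if v.1 (i + 1) < v.1 i then skewDivDiff w (v * simpleRefl i) (swapVars i f) else 0 := by
  classical
  -- This is `∂_w` applied to the twisted Leibniz rule for `∂_i (f g)`. The second summand gives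
  -- terms `∂_z ∂_i g`, which vanish at descents of `z` and equal `∂_{z s_i} g` at ascents; hence
  -- the filter and the reindexing.
  have key : skewCoeff (w * simpleRefl i) f = skewCoeff w (simpleDivDiff i f) +
      Finsupp.equivMapDomain (Equiv.mulRight (simpleRefl i))
        ((skewCoeff w (swapVars i f)).filter fun z => z.1 i < z.1 (i + 1)) := by
    refine skewCoeff_eq fun g => ?_
    rw [divDiff_mul_simple h, Module.End.mul_apply, simpleDivDiff_mul, map_add,
      divDiff_mul_eq_sum, divDiff_mul_eq_sum, Finsupp.sum_add_index' (fun _ => zero_mul _)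
      (fun _ _ _ => add_mul _ _ _), Finsupp.sum_equivMapDomain]
    congr 1
    rw [Finsupp.sum_filter_index, Finsupp.support_filter, Finset.sum_filter, Finsupp.sum]
    refine Finset.sum_congr rfl fun z _ => ?_
    split_ifs with hz
    · rw [Equiv.coe_mulRight, divDiff_mul_simple hz]
      rfl
    · have : z.1 (i + 1) < z.1 i := lt_of_le_of_ne (not_lt.mp hz) (apply_ne z (by omega))
      rw [← Module.End.mul_apply, divDiff_mul_simpleDivDiff_of_desc this, LinearMap.zero_apply,
        mul_zero]
  rw [← skewCoeff_apply, key, Finsupp.add_apply, skewCoeff_apply, Finsupp.equivMapDomain_apply,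
    Equiv.mulRight_symm, simpleRefl_inv, Equiv.coe_mulRight, Finsupp.filter_apply]
  exact congrArg _ (if_congr asc_mul_simple_iff rfl rfl)

theorem skewDivDiff_of_desc {i : ℕ} {w : SInf} (h : w.1 (i + 1) < w.1 i) (v : SInf)
    (f : Poly) : skewDivDiff w v f = skewDivDiff (w * simpleRefl i) v (simpleDivDiff i f) +
      if v.1 (i + 1) < v.1 i then skewDivDiff (w * simpleRefl i) (v * simpleRefl i) (swapVars i f)
      else 0 := by
  rw [← skewDivDiff_mul_simple (asc_mul_simple_iff.mpr h), simpleRefl_cancel_right]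

/-! ## Polynomials with nonnegative coefficients -/

/-- All coefficients of `p` are nonnegative. -/
def Nonneg (p : Poly) : Prop := ∀ m, 0 ≤ coeff m p

theorem nonneg_zero : Nonneg 0 := fun m => by rw [coeff_zero]

theorem Nonneg.add {p q : Poly} (hp : Nonneg p) (hq : Nonneg q) : Nonneg (p + q) := fun m => by
  rw [coeff_add]
  exact add_nonneg (hp m) (hq m)

theorem Nonneg.mul {p q : Poly} (hp : Nonneg p) (hq : Nonneg q) : Nonneg (p * q) := fun m => by
  classical
  rw [coeff_mul]
  exact Finset.sum_nonneg fun x _ => mul_nonneg (hp _) (hq _)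

theorem nonneg_sum {ι : Type*} {s : Finset ι} {p : ι → Poly} (h : ∀ i ∈ s, Nonneg (p i)) :
    Nonneg (∑ i ∈ s, p i) := fun m => by
  rw [coeff_sum]
  exact Finset.sum_nonneg fun i hi => h i hi m

theorem nonneg_one : Nonneg 1 := fun m => by
  classical
  rw [coeff_one]
  split_ifs <;> norm_num

theorem nonneg_X (i : ℕ) : Nonneg (X i) := fun m => by
  classical
  rw [coeff_X]
  split_ifs <;> norm_num

theorem nonneg_prod_X (A : Finset ℕ) : Nonneg (∏ j ∈ A, X j) :=
  Finset.prod_induction _ Nonneg (fun _ _ => Nonneg.mul) nonneg_one fun i _ => nonneg_X i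

/-- All skew divided differences of `f` have nonnegative coefficients. -/
def SkewPositive (f : Poly) : Prop := ∀ w v, Nonneg (skewDivDiff w v f)

theorem nonneg_skewDivDiff_one {f : Poly} (h : Nonneg f) (v : SInf) :
    Nonneg (skewDivDiff 1 v f) := by
  classical
  rw [← skewCoeff_apply, skewCoeff_one, Finsupp.single_apply]
  split_ifs
  exacts [h, nonneg_zero]

theorem skewPositive_one : SkewPositive 1 := by
  intro w v
  have : skewCoeff w 1 = Finsupp.single w 1 := skewCoeff_eq fun g => by
    rw [Finsupp.sum_single_index (zero_mul _), one_mul, one_mul]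
  classical
  rw [← skewCoeff_apply, this, Finsupp.single_apply]
  split_ifs
  exacts [nonneg_one, nonneg_zero]

theorem SkewPositive.mul {f g : Poly} (hf : SkewPositive f) (hg : SkewPositive g) :
    SkewPositive (f * g) := by
  intro w v
  rw [← skewCoeff_apply, skewCoeff_mul, Finsupp.sum_apply]
  refine nonneg_sum fun z _ => ?_
  exact (hf w z).mul (hg z v)

/-! ## Positivity for the products `x₁ ⋯ x_m` -/

theorem swapVars_prod_X_of_notMem {i : ℕ} {A : Finset ℕ} (h1 : i ∉ A) (h2 : i + 1 ∉ A) :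
    swapVars i (∏ j ∈ A, X j) = ∏ j ∈ A, X j := by
  rw [map_prod]
  refine Finset.prod_congr rfl fun j hj => swapVars_of_ne ?_ ?_ <;> rintro rfl <;> contradiction

/-- Positivity for a product of variables at left-to-right maxima of `w`. -/
theorem nonneg_skewDivDiff_prod_X (w v : SInf) (A : Finset ℕ)
    (hA : ∀ j ∈ A, ∀ p < j, w.1 p < w.1 j) : Nonneg (skewDivDiff w v (∏ j ∈ A, X j)) := by
  induction hn : invNum w generalizing w v A with
  | zero =>
    by_cases hw : w = 1
    · rw [hw]
      exact nonneg_skewDivDiff_one (nonneg_prod_X A) v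
    · obtain ⟨i, hi⟩ := exists_descent hw
      have := invNum_of_desc hi
      omega
  | succ n ih =>
    have hw : w ≠ 1 := by
      rintro rfl
      rw [invNum_one] at hn
      omega
    obtain ⟨i, hi⟩ := exists_descent hw
    have hlen := invNum_of_desc hi
    -- The position just after a descent is never a left-to-right maximum.
    have hi1 : i + 1 ∉ A := fun h => by
      have := hA _ h i (by omega)
      omega
    -- For `j` other than `i` and `i + 1`, the exchange permutes the positions before `j`, so
    -- left-to-right maxima at such `j` survive in `w s_i`.
    have step : ∀ (B : Finset ℕ) (v : SInf), i ∉ B → i + 1 ∉ B → (∀ j ∈ B, j ∈ A) →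
        Nonneg (skewDivDiff (w * simpleRefl i) v (∏ j ∈ B, X j)) := by
      intro B v h0 h1 hB
      refine ih _ _ _ (fun j hj p hp => ?_) (by omega)
      have hji : j ≠ i := fun h => h0 (h ▸ hj)
      have hji1 : j ≠ i + 1 := fun h => h1 (h ▸ hj)
      rw [mul_simple_apply, mul_simple_apply, Equiv.swap_apply_of_ne_of_ne hji hji1]
      refine hA j (hB j hj) _ ?_
      rw [Equiv.swap_apply_def]
      split_ifs <;> omega
    rw [skewDivDiff_of_desc hi]
    by_cases h0 : i ∈ A
    · set B := A.erase i with hB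
      have hB0 : i ∉ B := Finset.notMem_erase i A
      have hB1 : i + 1 ∉ B := fun h => hi1 (Finset.mem_of_mem_erase h)
      have hs := swapVars_prod_X_of_notMem hB0 hB1
      have e : (∏ j ∈ A, X j : Poly) = X i * ∏ j ∈ B, X j := (Finset.mul_prod_erase A X h0).symm
      have es : swapVars i (∏ j ∈ A, X j) = ∏ j ∈ insert (i + 1) B, X j := by
        rw [e, map_mul, swapVars_left, hs, Finset.prod_insert hB1]
      have ed : simpleDivDiff i (∏ j ∈ A, X j) = ∏ j ∈ B, X j := by
        refine simpleDivDiff_eq ?_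
        rw [e, map_mul, swapVars_left, hs]
        ring
      -- Neither term carries a sign: `∂_i` deletes the variable `X i`, and the exchange replaces it
      -- by `X (i + 1)`.
      rw [ed, es]
      refine (step B v hB0 hB1 fun j hj => Finset.mem_of_mem_erase hj).add ?_
      split_ifs
      · refine ih _ _ _ (fun j hj p hp => ?_) (by omega)
        rw [mul_simple_apply, mul_simple_apply]
        rcases Finset.mem_insert.mp hj with rfl | hj
        -- The maximum `w i` has moved to position `i + 1`; its new predecessor is the smaller value
        -- `w (i + 1)`.
        · rw [Equiv.swap_apply_right, Equiv.swap_apply_def]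
          split_ifs with h
          · exact hi
          · omega
          · exact hA i h0 p (by omega)
        · have hji : j ≠ i := fun h => hB0 (h ▸ hj)
          have hji1 : j ≠ i + 1 := fun h => hB1 (h ▸ hj)
          rw [Equiv.swap_apply_of_ne_of_ne hji hji1]
          refine hA j (Finset.mem_of_mem_erase hj) _ ?_
          rw [Equiv.swap_apply_def]
          split_ifs <;> omega
      · exact nonneg_zero
    · have hs := swapVars_prod_X_of_notMem h0 hi1
      rw [simpleDivDiff_of_symm hs, map_zero, zero_add, hs]
      split_ifs
      · exact step A _ h0 hi1 fun _ h => h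
      · exact nonneg_zero

/-- The product is symmetric in its variables, so a descent of `w` among the first `m` positions can
be stripped off without changing it. Otherwise `w` increases there, and these positions are all
left-to-right maxima. -/
theorem skewPositive_prod_range (m : ℕ) : SkewPositive (∏ j ∈ Finset.range m, X j) := by
  intro w v
  induction hn : invNum w using Nat.strong_induction_on generalizing w v with
  | _ n ih =>
    by_cases h : ∃ i, i + 1 < m ∧ w.1 (i + 1) < w.1 i
    · obtain ⟨i, him, hi⟩ := h
      have hlen := invNum_of_desc hi
      have hs : swapVars i (∏ j ∈ Finset.range m, X j) = ∏ j ∈ Finset.range m, X j := by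
        simpa using swapVars_prod_pow him (fun _ => 1) rfl
      rw [skewDivDiff_of_desc hi, simpleDivDiff_of_symm hs, map_zero, zero_add, hs]
      split_ifs
      · exact ih _ (by omega) _ _ rfl
      · exact nonneg_zero
    · push Not at h
      have hmono : ∀ j, j < m → ∀ p < j, w.1 p < w.1 j := by
        intro j
        induction j with
        | zero => intro _ p hp; omega
        | succ j ihj =>
          intro hj p hp
          have h1 := lt_of_le_of_ne (h j hj) (apply_ne w (by omega))
          rcases Nat.lt_succ_iff_lt_or_eq.mp hp with hp | rfl
          · exact (ihj (by omega) p hp).trans h1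
          · exact h1
      exact nonneg_skewDivDiff_prod_X w v _ fun j hj => hmono j (Finset.mem_range.mp hj)

/-- The positive exponents occupy an initial segment, so one factor `x₁ ⋯ x_m` splits off and leaves
exponents that still decrease weakly; the induction is on the largest exponent `c 0`. -/
theorem skewPositive_prod_pow (n : ℕ) (c : ℕ → ℕ) (hc : Antitone c) :
    SkewPositive (∏ j ∈ Finset.range n, X j ^ c j) := by
  induction hm : c 0 generalizing c with
  | zero =>
    rw [Finset.prod_eq_one fun j _ => by
      rw [show c j = 0 by have := hc (Nat.zero_le j); omega, pow_zero]]
    exact skewPositive_one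
  | succ a ih =>
    have hsplit : ∃ m, ∀ j < n, j < m ↔ 0 < c j := by
      by_cases hex : ∃ j, c j = 0
      · classical
        refine ⟨Nat.find hex, fun j _ => ⟨fun h => Nat.pos_of_ne_zero (Nat.find_min hex h),
          fun h => ?_⟩⟩
        by_contra hj
        have := hc (not_lt.mp hj)
        have := Nat.find_spec hex
        omega
      · push Not at hex
        exact ⟨n, fun j hj => ⟨fun _ => Nat.pos_of_ne_zero (hex j), fun _ => hj⟩⟩
    obtain ⟨m, hmc⟩ := hsplit
    have e : (∏ j ∈ Finset.range n, X j ^ c j : Poly) =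
        (∏ j ∈ Finset.range n, X j ^ (c j - 1)) * ∏ j ∈ Finset.range (min n m), X j := by
      have : (∏ j ∈ Finset.range (min n m), X j : Poly) =
          ∏ j ∈ Finset.range n, if j < m then X j else 1 := by
        rw [← Finset.prod_filter]
        congr 1
        ext j
        simp
      rw [this, ← Finset.prod_mul_distrib]
      refine Finset.prod_congr rfl fun j hj => ?_
      have := hmc j (Finset.mem_range.mp hj)
      split_ifs with h
      · rw [← pow_succ, Nat.sub_add_cancel (this.mp h)]
      · rw [show c j = 0 by omega, mul_one]
    rw [e]
    exact (ih (fun j => c j - 1) (fun i j h => Nat.sub_le_sub_right (hc h) 1)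
      (by omega)).mul (skewPositive_prod_range _)

/-! ## Schubert polynomials with a weakly decreasing code -/

/-- The Lehmer code: the number of values below `w i` that occur after the position `i`. -/
def code (w : SInf) (i : ℕ) : ℕ := ((Finset.range (w.1 i)).filter fun a => i < (w⁻¹).1 a).card

theorem inv_apply_self (w : SInf) (i : ℕ) : (w⁻¹).1 (w.1 i) = i := w.1.symm_apply_apply i

theorem inv_apply_eq {w : SInf} {a i : ℕ} (h : (w⁻¹).1 a = i) : w.1 i = a := by
  rw [← h]
  exact w.1.apply_symm_apply a

theorem mul_simple_inv_apply (w : SInf) (i a : ℕ) :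
    ((w * simpleRefl i)⁻¹).1 a = Equiv.swap i (i + 1) ((w⁻¹).1 a) := by
  rw [mul_inv_rev, simpleRefl_inv]
  rfl

/-! ### Adjacent entries of the code, and the code of `w s_i` -/

theorem code_le_of_asc {i : ℕ} {w : SInf} (h : w.1 i < w.1 (i + 1)) :
    code w i ≤ code w (i + 1) := by
  refine Finset.card_le_card fun a ha => ?_
  rw [Finset.mem_filter, Finset.mem_range] at ha ⊢
  refine ⟨by omega, lt_of_le_of_ne ha.2 fun e => ?_⟩
  have := inv_apply_eq e.symm
  omega

theorem code_lt_of_desc {i : ℕ} {w : SInf} (h : w.1 (i + 1) < w.1 i) :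
    code w (i + 1) < code w i := by
  refine Finset.card_lt_card ((Finset.ssubset_iff_of_subset fun a ha => ?_).mpr
    ⟨w.1 (i + 1), ?_, ?_⟩)
  · rw [Finset.mem_filter, Finset.mem_range] at ha ⊢
    omega
  · rw [Finset.mem_filter, Finset.mem_range, inv_apply_self]
    omega
  · rw [Finset.mem_filter, Finset.mem_range]
    omega

/-- The larger value moves to the left of `w i`, which becomes the one additional smaller value
after it. -/
theorem code_mul_simple_left {i : ℕ} {w : SInf} (h : w.1 i < w.1 (i + 1)) :
    code (w * simpleRefl i) i = code w (i + 1) + 1 := by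
  have hn : w.1 i ∉ (Finset.range (w.1 (i + 1))).filter fun a => i + 1 < (w⁻¹).1 a := by
    rw [Finset.mem_filter, inv_apply_self]
    omega
  rw [code, code, ← Finset.card_insert_of_notMem hn]
  congr 1
  ext a
  rw [Finset.mem_filter, Finset.mem_insert, Finset.mem_filter, Finset.mem_range, Finset.mem_range,
    mul_simple_apply, Equiv.swap_apply_left, mul_simple_inv_apply]
  have h1 := fun e => inv_apply_eq (w := w) (a := a) (i := i + 1) e
  have h2 : (w⁻¹).1 a = i ↔ a = w.1 i :=
    ⟨fun e => (inv_apply_eq e).symm, fun e => by rw [e, inv_apply_self]⟩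
  rw [Equiv.swap_apply_def]
  split_ifs <;> omega

theorem code_mul_simple_right {i : ℕ} {w : SInf} (h : w.1 i < w.1 (i + 1)) :
    code (w * simpleRefl i) (i + 1) = code w i := by
  rw [code, code]
  congr 1
  ext a
  rw [Finset.mem_filter, Finset.mem_filter, Finset.mem_range, Finset.mem_range,
    mul_simple_apply, Equiv.swap_apply_right, mul_simple_inv_apply]
  have h1 := fun e => inv_apply_eq (w := w) (a := a) (i := i + 1) e
  have h2 := fun e => inv_apply_eq (w := w) (a := a) (i := i) e
  rw [Equiv.swap_apply_def]
  split_ifs <;> omega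

theorem code_mul_simple_of_ne {i j : ℕ} (w : SInf) (h1 : j ≠ i) (h2 : j ≠ i + 1) :
    code (w * simpleRefl i) j = code w j := by
  rw [code, code]
  congr 1
  ext a
  rw [Finset.mem_filter, Finset.mem_filter, Finset.mem_range, Finset.mem_range, mul_simple_apply,
    Equiv.swap_apply_of_ne_of_ne h1 h2, mul_simple_inv_apply, Equiv.swap_apply_def]
  split_ifs <;> omega

/-! ### The longest element and the climb towards it -/

theorem code_longest {n i : ℕ} (hi : i < n) : code (longest n) i = n - 1 - i := by
  rw [code, Finset.filter_true_of_mem, Finset.card_range, longest_apply, if_pos hi]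
  intro a ha
  rw [Finset.mem_range, longest_apply, if_pos hi] at ha
  rw [longest_inv, longest_apply]
  split_ifs <;> omega

theorem eq_longest_of_desc {n : ℕ} {w : SInf} (hw : ∀ i, n ≤ i → w.1 i = i)
    (h : ∀ i, i + 1 < n → w.1 (i + 1) < w.1 i) : w = longest n := by
  -- Strict decrease bounds the values above when counted from the left and below when counted from
  -- the right; the two bounds coincide.
  have h1 : ∀ i, i < n → w.1 i + i < n := by
    intro i
    induction i with
    | zero => intro hi; exact apply_lt_bound hw hi
    | succ i ih =>
      intro hi
      have := ih (by omega)
      have := h i hi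
      omega
  have h2 : ∀ t, t < n → t ≤ w.1 (n - 1 - t) := by
    intro t
    induction t with
    | zero => intro _; exact Nat.zero_le _
    | succ t ih =>
      intro ht
      have e1 := ih (by omega)
      have e2 := h (n - 1 - (t + 1)) (by omega)
      rw [show n - 1 - (t + 1) + 1 = n - 1 - t by omega] at e2
      omega
  refine Subtype.ext (Equiv.ext fun i => ?_)
  rw [longest_apply]
  split_ifs with hi
  · have e1 := h1 i hi
    have e2 := h2 (n - 1 - i) (by omega)
    rw [show n - 1 - (n - 1 - i) = i by omega] at e2
    omega
  · exact hw i (by omega)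

theorem mul_simple_fixes {n i : ℕ} {w : SInf} (hw : ∀ j, n ≤ j → w.1 j = j) (hi : i + 1 < n) :
    ∀ j, n ≤ j → (w * simpleRefl i).1 j = j := by
  intro j hj
  rw [mul_simple_apply, Equiv.swap_apply_of_ne_of_ne (by omega) (by omega), hw j hj]

/-- Provides the decreasing measure for inductions that climb from `w` to the longest element of
`Sₙ` through ascents. -/
theorem invNum_longest_of_asc {n i : ℕ} {w : SInf} (hw : ∀ j, n ≤ j → w.1 j = j) (hi : i + 1 < n)
    (h : w.1 i < w.1 (i + 1)) :
    invNum (w⁻¹ * longest n) = invNum ((w * simpleRefl i)⁻¹ * longest n) + 1 := by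
  rw [mul_simple_inv_mul]
  refine invNum_mul_of_not_asc fun hc => ?_
  have := (leftAsc_longest hw hi).mp hc
  omega

theorem schubert_of_asc {i : ℕ} {w : SInf} (h : w.1 i < w.1 (i + 1)) :
    schubert w = simpleDivDiff i (schubert (w * simpleRefl i)) := by
  have hd : (w * simpleRefl i).1 (i + 1) < (w * simpleRefl i).1 i := by
    rwa [mul_simple_apply, mul_simple_apply, Equiv.swap_apply_left, Equiv.swap_apply_right]
  rw [isSchubertFamily_schubert.2 _ i hd, simpleRefl_cancel_right]

/-- The Schubert polynomial of a dominant permutation is the monomial of its code. -/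
theorem schubert_eq_prod_code {n : ℕ} (w : SInf) (hw : ∀ i, n ≤ i → w.1 i = i)
    (hc : Antitone (code w)) : schubert w = ∏ j ∈ Finset.range n, X j ^ code w j := by
  induction hm : invNum (w⁻¹ * longest n) using Nat.strong_induction_on generalizing w with
  | _ m ih =>
    by_cases h : ∃ i, i + 1 < n ∧ w.1 i < w.1 (i + 1)
    · classical
      -- The first ascent is chosen so that `i - 1`, if it exists, is a descent. The code then drops
      -- strictly before `i`, leaving room to raise its entry at `i` by one and stay dominant.
      obtain ⟨i, ⟨hin, hi⟩, hmin⟩ : ∃ i, (i + 1 < n ∧ w.1 i < w.1 (i + 1)) ∧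
          ∀ j < i, ¬ (j + 1 < n ∧ w.1 j < w.1 (j + 1)) :=
        ⟨Nat.find h, Nat.find_spec h, fun j => Nat.find_min h⟩
      have hlen := invNum_longest_of_asc hw hin hi
      have hceq : code w i = code w (i + 1) := le_antisymm (code_le_of_asc hi) (hc (by omega))
      have e1 := code_mul_simple_left hi
      have e2 := code_mul_simple_right hi
      have e3 := fun j => code_mul_simple_of_ne (i := i) (j := j) w
      have hanti : Antitone (code (w * simpleRefl i)) := by
        refine antitone_nat_of_succ_le fun j => ?_
        have hj := hc (Nat.le_succ j)
        rw [Nat.succ_eq_add_one] at hj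
        rcases lt_trichotomy j i with h | rfl | h
        · rw [e3 j (by omega) (by omega)]
          by_cases hji : j + 1 = i
          · have hd : w.1 (j + 1) < w.1 j :=
              lt_of_le_of_ne (not_lt.mp fun hlt => hmin j h ⟨by omega, hlt⟩)
                (apply_ne w (by omega))
            have := code_lt_of_desc hd
            rw [hji] at this ⊢
            omega
          · rwa [e3 (j + 1) hji (by omega)]
        · omega
        · rw [e3 (j + 1) (by omega) (by omega)]
          by_cases hji : j = i + 1
          · rw [hji] at hj ⊢
            omega
          · rwa [e3 j (by omega) hji]
      have hprod : (∏ j ∈ Finset.range n, X j ^ code (w * simpleRefl i) j : Poly) =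
          X i * ∏ j ∈ Finset.range n, X j ^ code w j := by
        have : (X i : Poly) = ∏ j ∈ Finset.range n, if j = i then X i else 1 := by
          rw [Finset.prod_ite_eq' (Finset.range n) i fun _ => (X i : Poly),
            if_pos (Finset.mem_range.mpr (by omega))]
        rw [this, ← Finset.prod_mul_distrib]
        refine Finset.prod_congr rfl fun j _ => ?_
        split_ifs with hji
        · rw [hji, e1, ← hceq, pow_succ']
        · by_cases hji' : j = i + 1
          · rw [hji', e2, hceq, one_mul]
          · rw [e3 j hji hji', one_mul]
      rw [schubert_of_asc hi, ih _ (by omega) _ (mul_simple_fixes hw hin) hanti rfl, hprod]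
      -- The exponents at `i` and `i + 1` agree, so the monomial of `code w` is symmetric in these
      -- variables and `∂_i` acts only on the extra factor `X i`.
      refine simpleDivDiff_eq ?_
      rw [map_mul, swapVars_left, swapVars_prod_pow hin _ hceq]
      ring
    · push Not at h
      have hl := eq_longest_of_desc hw fun i hi =>
        lt_of_le_of_ne (h i hi) (apply_ne w (by omega))
      rw [hl, isSchubertFamily_schubert.1, staircase]
      exact Finset.prod_congr rfl fun j hj => by rw [code_longest (Finset.mem_range.mp hj)]

/-! ## Separated descents -/

/-- If `v` has an ascent at `i`, then `∂_i` preserves the positivity of all the `∂_{w/v}`. -/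
theorem nonneg_skewDivDiff_simpleDivDiff {i : ℕ} {v : SInf} (hv : v.1 i < v.1 (i + 1)) {f : Poly}
    (hf : ∀ w, Nonneg (skewDivDiff w v f)) (w : SInf) :
    Nonneg (skewDivDiff w v (simpleDivDiff i f)) := by
  rcases lt_or_gt_of_ne (apply_ne w (Nat.succ_ne_self i).symm) with h | h
  · have := skewDivDiff_mul_simple h v f
    rw [if_neg (by omega), add_zero] at this
    rw [← this]
    exact hf _
  -- At a descent of `w`, the recursion applies `∂_i` a second time, which gives zero.
  · rw [skewDivDiff_of_desc h, if_neg (by omega), add_zero, ← Module.End.mul_apply (simpleDivDiff i),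
      simpleDivDiff_sq, LinearMap.zero_apply, map_zero]
    exact nonneg_zero

/-- The code drops at each descent before `k` and vanishes from `k` on, where `u` increases. The
step from `k - 1` to `k` needs no condition on `u`, because it ends at zero. -/
theorem antitone_code {k : ℕ} {u : SInf} (h1 : ∀ i, i + 1 < k → u.1 (i + 1) < u.1 i)
    (h2 : ∀ i, k ≤ i → u.1 i < u.1 (i + 1)) : Antitone (code u) := by
  have hmono : ∀ i, k ≤ i → ∀ j, i ≤ j → u.1 i ≤ u.1 j := by
    intro i hi j hj
    induction j, hj using Nat.le_induction with
    | base => exact le_rfl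
    | succ j hj ih => exact ih.trans (h2 j (by omega)).le
  refine antitone_nat_of_succ_le fun i => ?_
  by_cases hi : i + 1 < k
  · exact (code_lt_of_desc (h1 i hi)).le
  · have : code u (i + 1) = 0 := by
      rw [code, Finset.card_eq_zero, Finset.filter_eq_empty_iff]
      intro a ha hc
      have := hmono (i + 1) (by omega) _ hc.le
      rw [inv_apply_eq rfl] at this
      rw [Finset.mem_range] at ha
      omega
    omega

/-- Climbing from `u` through ascents before `k` keeps `v` fixed but changes `w`, so the induction
ranges over all `w`. The bound `k ≤ n` keeps the climb inside `Sₙ`; it ends at a dominant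
permutation. -/
theorem nonneg_skewDivDiff_schubert {k n : ℕ} (hkn : k ≤ n) {v : SInf}
    (hv : ∀ i, i + 1 < k → v.1 i < v.1 (i + 1)) (u : SInf) (hun : ∀ i, n ≤ i → u.1 i = i)
    (hu : ∀ i, k ≤ i → u.1 i < u.1 (i + 1)) (w : SInf) :
    Nonneg (skewDivDiff w v (schubert u)) := by
  induction hm : invNum (u⁻¹ * longest n) using Nat.strong_induction_on generalizing u w with
  | _ m ih =>
    by_cases h : ∃ i, i + 1 < k ∧ u.1 i < u.1 (i + 1)
    · obtain ⟨i, hik, hi⟩ := h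
      have hlen := invNum_longest_of_asc hun (by omega) hi
      rw [schubert_of_asc hi]
      refine nonneg_skewDivDiff_simpleDivDiff (hv i hik) (fun w => ?_) w
      refine ih _ (by omega) _ (mul_simple_fixes hun (by omega)) (fun j hj => ?_) w rfl
      rw [mul_simple_apply, mul_simple_apply, Equiv.swap_apply_of_ne_of_ne (by omega) (by omega),
        Equiv.swap_apply_of_ne_of_ne (by omega) (by omega)]
      exact hu j hj
    · push Not at h
      have hc := antitone_code (fun i hi => lt_of_le_of_ne (h i hi) (apply_ne u (by omega))) hu
      rw [schubert_eq_prod_code u hun hc]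
      exact skewPositive_prod_pow n _ hc w v

end SchubertCalc

theorem mainTheorem3 (u v w : SchubertCalc.SInf) (huv : SchubertCalc.SeparatedDescents u v)
    (m : ℕ →₀ ℕ) :
    0 ≤ MvPolynomial.coeff m (SchubertCalc.skewDivDiff w v (SchubertCalc.schubert u)) := by
  obtain ⟨k, hu, hv⟩ := huv
  obtain ⟨n, hn⟩ := u.2
  -- A descent at the index `i` counts as position `i + 1`. Hence `v` has none with `i + 1 < k` and
  -- `u` has none with `k ≤ i`. Taking the maximum with `k` ensures `k ≤ n`.
  refine SchubertCalc.nonneg_skewDivDiff_schubert (le_max_left k n) (fun i hi => ?_) u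
    (fun i hi => hn i (le_trans (le_max_right k n) hi)) (fun i hi => ?_) w m
  · by_contra hc
    have hd : v.1 (i + 1) < v.1 i :=
      lt_of_le_of_ne (not_lt.mp hc) (SchubertCalc.apply_ne v (by omega))
    have : ((k : ℕ) : ℕ∞) ≤ ((i + 1 : ℕ) : ℕ∞) := hv.trans (iInf₂_le i hd)
    have := ENat.natCast_le_natCast.mp this
    omega
  · by_contra hc
    have hd : u.1 (i + 1) < u.1 i :=
      lt_of_le_of_ne (not_lt.mp hc) (SchubertCalc.apply_ne u (by omega))
    have : ((i + 1 : ℕ) : ℕ∞) ≤ ((k : ℕ) : ℕ∞) :=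
      (le_iSup₂ (f := fun (i : ℕ) (_ : i ∈ {i : ℕ | u.1 (i + 1) < u.1 i}) =>
        ((i + 1 : ℕ) : ℕ∞)) i hd).trans hu
    have := ENat.natCast_le_natCast.mp this
    omega
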